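/- Let $R$ be a commutative ring with unit. A functor of $\mathcal R$-modules is a covariant functor $\mathbb M$ from the category of commutative $R$-algebras to abelian groups together with an $S$-module structure on $\mathbb M(S)$ for every commutative $R$-algebra $S$, functorial in $S$; a morphism of functors of $\mathcal R$-modules is a natural transformation whose components are $S$-linear for every $S$. Write $\mathcal R$ for the functor $S\mapsto S$, and let $\mathbb M^*$ be the functor of $\mathcal R$-modules $S\mapsto \mathrm{Hom}_{\mathcal S}(\mathbb M_{|S},\mathcal R_{|S})$, where $\mathbb M_{|S}$ denotes the restriction of $\mathbb M$ to commutative $S$-algebras and $\mathrm{Hom}_{\mathcal S}$ denotes morphisms of functors of modules on these. A functor of $\mathcal R$-modules is a dual functor if it is isomorphic to $\mathbb N^*$ for some functor of $\mathcal R$-modules $\mathbb N$. It is essentially free if it is isomorphic to $\varprojlim_{\alpha\in P}\mathcal R^{(\alpha)}$ for some set $I$ and some set $P$ of subsets of $I$ closed under binary unions, where $\mathcal R^{(\alpha)}(S)=\bigoplus_{\alpha}S$ and, for $\alpha\subseteq\beta$ in $P$, the transition map $\mathcal R^{(\beta)}\to\mathcal R^{(\alpha)}$ restricts families from $\beta$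 to $\alpha$. A functor of $\mathcal R$-algebras is a functor $\mathbb A$ from commutative $R$-algebras to associative unital rings together with a morphism of functors of rings $\mathcal R\to\mathbb A$ such that the image of $S$ in $\mathbb A(S)$ is central for every $S$. A functor of $\mathbb A$-modules is a functor $\mathbb M$ from commutative $R$-algebras to abelian groups together with an $\mathbb A(S)$-module structure on $\mathbb M(S)$ for every $S$, functorial in $S$; it is a functor of $\mathcal R$-modules via $\mathcal R\to\mathbb A$. Let $\mathbb A$ be a functor of $\mathcal R$-algebras which is essentially free as a functor of $\mathcal R$-modules, let $\mathbb M$ be a functor of $\mathbb A$-modules which is essentially free as a functor of $\mathcal R$-modules, and let $\mathbb M'$ be a functor of $\mathbb A$-modules which is a dual functor as a functor of $\mathcal R$-modules. Let $f\colon\mathbb M\to\mathbb M'$ be a morphism of functors of $\mathcal R$-modules. Then $f$ is a morphism of functors of $\mathbb A$-modules (that is, $f_S\colon\mathbb M(S)\to\mathbb M'(S)$ is $\mathbb A(S)$-linear for every commutative $R$-algebra $S$) if and only if $f_R\colon\mathbb M(R)\to\mathbb M'(R)$ is $\mathbb A(R)$-linear. -/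

import Mathlib

open CategoryTheory

universe u w w₁ w₂ w₃ w₄

noncomputable section

namespace EssFree

/-- A functor of `𝓡`-modules: a covariant functor from commutative `R`-algebras to abelian groups
together with a natural structure of `S`-module on the value at every `S`. -/
structure ModFunctor (R : Type u) [CommRing R] extends CommAlgCat.{u} R ⥤ AddCommGrpCat.{w} where
  module : ∀ S : CommAlgCat.{u} R, Module S (toFunctor.obj S)
  map_smul : ∀ {S T : CommAlgCat.{u} R} (φ : S ⟶ T) (s : S) (m : toFunctor.obj S),
    (toFunctor.map φ).hom (s • m) = φ.hom s • (toFunctor.map φ).hom m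

attribute [instance] ModFunctor.module

/-- A functor of `𝓡`-algebras: a functor of (associative, unital) rings together with a natural
ring homomorphism from `𝓡` with central image. -/
structure AlgFunctor (R : Type u) [CommRing R] extends CommAlgCat.{u} R ⥤ RingCat.{w} where
  algebra : ∀ S : CommAlgCat.{u} R, Algebra S (toFunctor.obj S)
  map_algebraMap : ∀ {S T : CommAlgCat.{u} R} (φ : S ⟶ T) (s : S),
    (toFunctor.map φ).hom (algebraMap S (toFunctor.obj S) s) =
      algebraMap T (toFunctor.obj T) (φ.hom s)

attribute [instance] AlgFunctor.algebra

variable {R : Type u} [CommRing R]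

/-- The functor of `𝓡`-modules underlying a functor of `𝓡`-algebras. -/
def AlgFunctor.toModFunctor (A : AlgFunctor.{u, w} R) : ModFunctor.{u, w} R where
  obj S := AddCommGrpCat.of (A.obj S)
  map φ := AddCommGrpCat.ofHom (A.map φ).hom.toAddMonoidHom
  map_id S := by
    apply AddCommGrpCat.hom_ext; apply AddMonoidHom.ext; intro a
    change (A.map (𝟙 S)).hom a = a
    rw [A.map_id]
    rfl
  map_comp φ ψ := by
    apply AddCommGrpCat.hom_ext; apply AddMonoidHom.ext; intro a
    change (A.map (φ ≫ ψ)).hom a = (A.map ψ).hom ((A.map φ).hom a)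
    rw [A.map_comp]
    rfl
  module S := inferInstanceAs (Module S (A.obj S))
  map_smul {S T} φ s (m : A.obj S) := by
    change (A.map φ).hom (s • m) = φ.hom s • ((A.map φ).hom m : A.obj T)
    rw [Algebra.smul_def, Algebra.smul_def, _root_.map_mul, A.map_algebraMap]

/-- A functor of `A`-modules; its `𝓡`-module structure is the one induced by `𝓡 → A`. -/
structure AModFunctor (A : AlgFunctor.{u, w₁} R) extends ModFunctor.{u, w₂} R where
  amodule : ∀ S : CommAlgCat.{u} R, Module (A.obj S) (toFunctor.obj S)
  scalarTower : ∀ S : CommAlgCat.{u} R, IsScalarTower S (A.obj S) (toFunctor.obj S)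
  map_asmul : ∀ {S T : CommAlgCat.{u} R} (φ : S ⟶ T) (a : A.obj S) (m : toFunctor.obj S),
    (toFunctor.map φ).hom (a • m) = (A.map φ).hom a • (toFunctor.map φ).hom m

attribute [instance] AModFunctor.amodule AModFunctor.scalarTower

/-- Morphisms of functors of `𝓡`-modules. -/
structure ModFunctor.Hom (M : ModFunctor.{u, w₁} R) (N : ModFunctor.{u, w₂} R) where
  app : ∀ S : CommAlgCat.{u} R, M.obj S →ₗ[S] N.obj S
  naturality : ∀ {S T : CommAlgCat.{u} R} (φ : S ⟶ T) (m : M.obj S),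
    (N.map φ).hom (app S m) = app T ((M.map φ).hom m)

/-- Isomorphisms of functors of `𝓡`-modules. -/
structure ModFunctor.Iso (M : ModFunctor.{u, w₁} R) (N : ModFunctor.{u, w₂} R) where
  app : ∀ S : CommAlgCat.{u} R, M.obj S ≃ₗ[S] N.obj S
  naturality : ∀ {S T : CommAlgCat.{u} R} (φ : S ⟶ T) (m : M.obj S),
    (N.map φ).hom (app S m) = app T ((M.map φ).hom m)

/-- The functor `𝓡`, `𝓡(S) = S`, as a functor of `𝓡`-modules. -/
def baseFunctor (R : Type u) [CommRing R] : ModFunctor.{u, u} R where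
  obj S := AddCommGrpCat.of S
  map φ := AddCommGrpCat.ofHom φ.hom.toRingHom.toAddMonoidHom
  map_id _ := rfl
  map_comp _ _ := rfl
  module S := inferInstanceAs (Module S S)
  map_smul φ s m := _root_.map_mul φ.hom s m

/-- The group of morphisms of `𝓢`-modules `M|_S → N|_S`. A commutative `S`-algebra is given as a
commutative `R`-algebra `T` with a morphism of `R`-algebras `φ : S ⟶ T`; a morphism of `S`-algebras
from `(T, φ)` to `(T', φ')` is then a `ψ : T ⟶ T'` with `φ ≫ ψ = φ'`. -/
def restrictedHom (M : ModFunctor.{u, w₁} R) (N : ModFunctor.{u, w₂} R) (S : CommAlgCat.{u} R) :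
    AddSubgroup (∀ (T : CommAlgCat.{u} R) (_ : S ⟶ T), M.obj T →ₗ[T] N.obj T) where
  carrier := {f | ∀ (T T' : CommAlgCat.{u} R) (φ : S ⟶ T) (ψ : T ⟶ T') (m : M.obj T),
    (N.map ψ).hom (f T φ m) = f T' (φ ≫ ψ) ((M.map ψ).hom m)}
  zero_mem' := by intro T T' φ ψ m; simp
  add_mem' := by
    intro f g hf hg T T' φ ψ m
    simp [hf T T' φ ψ m, hg T T' φ ψ m]
  neg_mem' := by
    intro f hf T T' φ ψ m
    simp [hf T T' φ ψ m]

/-- `S` acts on `restrictedHom M N S` through the values: `(s • f)(m) = φ(s) • f(m)`. -/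
instance restrictedHomModule (M : ModFunctor.{u, w₁} R) (N : ModFunctor.{u, w₂} R)
    (S : CommAlgCat.{u} R) : Module S (restrictedHom M N S) where
  smul s f := ⟨fun T φ => φ.hom s • f.1 T φ, by
    intro T T' φ ψ m
    simp only [LinearMap.smul_apply]
    rw [N.map_smul, f.2 T T' φ ψ m]
    rfl⟩
  one_smul f := by
    apply Subtype.ext; funext T φ
    change φ.hom 1 • f.1 T φ = f.1 T φ
    simp
  mul_smul a b f := by
    apply Subtype.ext; funext T φ
    change φ.hom (a * b) • f.1 T φ = φ.hom a • φ.hom b • f.1 T φ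
    rw [_root_.map_mul, mul_smul]
  smul_zero a := by
    apply Subtype.ext; funext T φ
    change φ.hom a • (0 : M.obj T →ₗ[T] N.obj T) = 0
    simp
  smul_add a f g := by
    apply Subtype.ext; funext T φ
    change φ.hom a • (f.1 T φ + g.1 T φ) = φ.hom a • f.1 T φ + φ.hom a • g.1 T φ
    simp
  add_smul a b f := by
    apply Subtype.ext; funext T φ
    change φ.hom (a + b) • f.1 T φ = φ.hom a • f.1 T φ + φ.hom b • f.1 T φ
    rw [_root_.map_add, add_smul]
  zero_smul f := by
    apply Subtype.ext; funext T φ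
    change φ.hom 0 • f.1 T φ = 0
    simp

/-- Restriction of a morphism of `𝓢`-modules along `φ : S ⟶ S'`. -/
def restrictedHomMap (M : ModFunctor.{u, w₁} R) (N : ModFunctor.{u, w₂} R)
    {S S' : CommAlgCat.{u} R} (φ : S ⟶ S') : restrictedHom M N S →+ restrictedHom M N S' where
  toFun f := ⟨fun T ψ => f.1 T (φ ≫ ψ), by
    intro T T' ψ χ m
    have := f.2 T T' (φ ≫ ψ) χ m
    rwa [Category.assoc] at this⟩
  map_zero' := rfl
  map_add' _ _ := rfl

/-- The functor of `𝓡`-modules `ℍom_𝓡(M, N)`, `S ↦ Hom_𝓢(M|_S, N|_S)`. -/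
def internalHom (M : ModFunctor.{u, w₁} R) (N : ModFunctor.{u, w₂} R) :
    ModFunctor.{u, max (u + 1) w₁ w₂} R where
  obj S := AddCommGrpCat.of (restrictedHom M N S)
  map φ := AddCommGrpCat.ofHom (restrictedHomMap M N φ)
  map_id S := by
    apply AddCommGrpCat.hom_ext; apply AddMonoidHom.ext; intro f
    apply Subtype.ext; funext T φ
    change f.1 T (𝟙 S ≫ φ) = f.1 T φ
    rw [Category.id_comp]
  map_comp φ ψ := by
    apply AddCommGrpCat.hom_ext; apply AddMonoidHom.ext; intro f
    apply Subtype.ext; funext T χ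
    change f.1 T ((φ ≫ ψ) ≫ χ) = f.1 T (φ ≫ ψ ≫ χ)
    rw [Category.assoc]
  module S := restrictedHomModule M N S
  map_smul _ _ _ := rfl

/-- The dual `M^* = ℍom_𝓡(M, 𝓡)`. -/
def dual (M : ModFunctor.{u, w} R) : ModFunctor.{u, max (u + 1) w} R :=
  internalHom M (baseFunctor R)

/-- `M` is a dual functor: it is isomorphic to `N^*` for some functor of `𝓡`-modules `N`. -/
def IsDualFunctor (M : ModFunctor.{u, w₁} R) : Prop :=
  ∃ N : ModFunctor.{u, w₂} R, Nonempty (ModFunctor.Iso M (dual N))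

/-- The inverse limit over `α ∈ P`, ordered by inclusion, of the modules `S^(α) = ⨁_α S`, the
transition map `S^(β) → S^(α)` for `α ⊆ β` being the restriction of the families to `α`. -/
def limFree {I : Type u} (P : Set (Set I)) (S : Type u) [CommRing S] :
    Submodule S (∀ α : P, (α.1 →₀ S)) where
  carrier := {x | ∀ (α β : P) (h : α.1 ⊆ β.1) (i : α.1), x β ⟨i.1, h i.2⟩ = x α i}
  zero_mem' := by intro α β h i; simp
  add_mem' := by
    intro x y hx hy α β h i
    simp [hx α β h i, hy α β h i]
  smul_mem' := by
    intro s x hx α β h i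
    simp [hx α β h i]

/-- Functoriality of `limFree` in the ring of coefficients. -/
def limFreeMap {I : Type u} (P : Set (Set I)) {S T : Type u} [CommRing S] [CommRing T]
    (φ : S →+* T) : limFree P S →+ limFree P T where
  toFun x := ⟨fun α => (x.1 α).mapRange φ (_root_.map_zero φ), by
    intro α β h i
    simp [x.2 α β h i]⟩
  map_zero' := by
    apply Subtype.ext; funext α; ext i
    simp
  map_add' x y := by
    apply Subtype.ext; funext α; ext i
    simp

/-- The functor of `𝓡`-modules `lim_{α ∈ P} 𝓡^(α)`. -/
def limFreeFunctor (R : Type u) [CommRing R] {I : Type u} (P : Set (Set I)) :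
    ModFunctor.{u, u} R where
  obj S := AddCommGrpCat.of (limFree P S)
  map φ := AddCommGrpCat.ofHom (limFreeMap P φ.hom.toRingHom)
  map_id S := by
    apply AddCommGrpCat.hom_ext; apply AddMonoidHom.ext; intro x
    apply Subtype.ext; funext α; apply Finsupp.ext; intro i
    rfl
  map_comp φ ψ := by
    apply AddCommGrpCat.hom_ext; apply AddMonoidHom.ext; intro x
    apply Subtype.ext; funext α; apply Finsupp.ext; intro i
    rfl
  module S := inferInstanceAs (Module S (limFree P S))
  map_smul {S T} φ s x := by
    apply Subtype.ext; funext α; apply Finsupp.ext; intro i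
    exact _root_.map_mul φ.hom s (x.1 α i)

/-- `M` is essentially free: `M ≃ lim_{α ∈ P} 𝓡^(α)` for some set `I` and some set `P` of subsets
of `I` which is stable under binary unions. -/
def IsEssentiallyFree (M : ModFunctor.{u, w} R) : Prop :=
  ∃ (I : Type u) (P : Set (Set I)), (∀ α ∈ P, ∀ β ∈ P, α ∪ β ∈ P) ∧
    Nonempty (ModFunctor.Iso M (limFreeFunctor R P))

/-- A morphism of functors of `𝓡`-modules between functors of `A`-modules is a morphism of functors
of `A`-modules: every component is `A(S)`-linear. -/
def IsAModHom {A : AlgFunctor.{u, w₁} R} (M : AModFunctor.{u, w₁, w₂} A)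
    (M' : AModFunctor.{u, w₁, w₃} A) (f : ModFunctor.Hom M.toModFunctor M'.toModFunctor) : Prop :=
  ∀ S : CommAlgCat.{u} R, IsLinearMap (A.obj S) (f.app S)

end EssFree

end

open MvPolynomial in
/-- A polynomial takes the same value at two points that agree on its variables. -/
theorem MvPolynomial.aeval_eq_of_eqOn_vars {σ S : Type*} [CommRing S] (p : MvPolynomial σ S)
    {c d : σ → S} (h : ∀ i ∈ p.vars, c i = d i) : aeval c p = aeval d p := by
  have := eval₂Hom_congr' (f₁ := RingHom.id S) (f₂ := RingHom.id S) (g₁ := c) (g₂ := d)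
    (p₁ := p) (p₂ := p) rfl (fun i hi _ => h i hi) rfl
  simpa [aeval_def, coe_eval₂Hom] using this

namespace EssFree

variable {R : Type u} [CommRing R]

section limFree

variable {I : Type u} (P : Set (Set I))

/-- Coordinatewise multiplication of a fixed element of `limFree P S` by families of scalars. -/
noncomputable def limFreeScale {S : Type u} [CommRing S] (x : limFree P S) : (I → S) →ₗ[S] limFree P S where
  toFun c := ⟨fun α => Finsupp.onFinset (x.1 α).support (fun i => c i.1 * x.1 α i) (by
      intro i hi
      rw [Finsupp.mem_support_iff]
      intro h
      exact hi (by rw [h, mul_zero])), by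
    intro α β h i
    simp [x.2 α β h i]⟩
  map_add' c d := by
    apply Subtype.ext; funext α; ext i
    simp [add_mul]
  map_smul' s c := by
    apply Subtype.ext; funext α; ext i
    simp [mul_assoc]

theorem limFreeScale_apply {S : Type u} [CommRing S] (x : limFree P S) (c : I → S) (α : P)
    (i : α.1) : (limFreeScale P x c).1 α i = c i.1 * x.1 α i := rfl

theorem limFreeScale_one {S : Type u} [CommRing S] (x : limFree P S) :
    limFreeScale P x 1 = x := by
  apply Subtype.ext; funext α; ext i
  rw [limFreeScale_apply, Pi.one_apply, one_mul]

theorem limFreeMap_limFreeScale {S T : Type u} [CommRing S] [CommRing T] (φ : S →+* T)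
    (x : limFree P S) (c : I → S) :
    limFreeMap P φ (limFreeScale P x c) = limFreeScale P (limFreeMap P φ x) (φ ∘ c) := by
  apply Subtype.ext; funext α; ext i
  exact _root_.map_mul φ _ _

/-- The family with entry `1` at `j` and `0` elsewhere. -/
noncomputable def limFreeSingle (S : Type u) [CommRing S] (j : I) : limFree P S :=
  ⟨fun α => (Finsupp.single j (1 : S)).subtypeDomain (· ∈ α.1), fun _ _ _ _ => rfl⟩

theorem limFreeMap_limFreeSingle {S T : Type u} [CommRing S] [CommRing T] (φ : S →+* T) (j : I) :
    limFreeMap P φ (limFreeSingle P S j) = limFreeSingle P T j := by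
  classical
  apply Subtype.ext; funext α; ext i
  change φ (Finsupp.single j (1 : S) i.1) = Finsupp.single j (1 : T) i.1
  rw [Finsupp.single_apply, Finsupp.single_apply]
  split_ifs <;> simp

theorem exists_limFreeScale_single [DecidableEq I] {P : Set (Set I)}
    (hP : ∀ α ∈ P, ∀ β ∈ P, α ∪ β ∈ P) {S : Type u} [CommRing S] (x : limFree P S) (j : I) :
    ∃ s : S, limFreeScale P x (Pi.single j 1) = s • limFreeSingle P S j := by
  by_cases hj : ∃ α : P, j ∈ α.1
  · obtain ⟨β, hβ⟩ := hj
    refine ⟨x.1 β ⟨j, hβ⟩, ?_⟩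
    apply Subtype.ext; funext α; ext i
    rw [limFreeScale_apply]
    change _ = x.1 β ⟨j, hβ⟩ * Finsupp.single j (1 : S) i.1
    rw [Finsupp.single_apply, Pi.single_apply]
    obtain ⟨i, hi⟩ := i
    by_cases h : i = j
    · subst h
      let γ : P := ⟨α.1 ∪ β.1, hP _ α.2 _ β.2⟩
      rw [if_pos rfl, one_mul, mul_one, ← x.2 α γ Set.subset_union_left ⟨i, hi⟩,
        ← x.2 β γ Set.subset_union_right ⟨i, hβ⟩]
    · simp [h, Ne.symm h]
  · refine ⟨0, ?_⟩
    apply Subtype.ext; funext α; ext i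
    have : i.1 ≠ j := fun h => hj ⟨α, h ▸ i.2⟩
    rw [limFreeScale_apply, Pi.single_eq_of_ne this]
    simp

end limFree

/-- The structure morphism `R ⟶ S` of a commutative `R`-algebra. -/
noncomputable def structureMap (S : CommAlgCat.{u} R) : CommAlgCat.of R R ⟶ S :=
  CommAlgCat.ofHom (Algebra.ofId R S)

/-- A linear form on `lim 𝓡^(α)` over `S` that vanishes on the unit families vanishes: its value
at the generic multiple `(z_i x_i)` of `x` is a polynomial, which involves finitely many `z_i`. -/
theorem restrictedHom_limFree_eq_zero {I : Type u} {P : Set (Set I)}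
    (hP : ∀ α ∈ P, ∀ β ∈ P, α ∪ β ∈ P) (S : CommAlgCat.{u} R) (h : restrictedHom (limFreeFunctor R P) (baseFunctor R) S)
    (hj : ∀ j, h.1 S (𝟙 S) (limFreeSingle P S j) = 0) (x : limFree P S) :
    h.1 S (𝟙 S) x = 0 := by
  classical
  let L : (I → S) →ₗ[S] S := (h.1 S (𝟙 S)).comp (limFreeScale P x)
  let T : CommAlgCat.{u} R := CommAlgCat.of R (MvPolynomial I S)
  let ι : S ⟶ T := CommAlgCat.ofHom (IsScalarTower.toAlgHom R S (MvPolynomial I S))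
  let ev (c : I → S) : T ⟶ S :=
    CommAlgCat.ofHom ((MvPolynomial.aeval (R := S) c).restrictScalars R)
  have hev (c : I → S) : ι ≫ ev c = 𝟙 S := by
    apply CommAlgCat.hom_ext
    apply AlgHom.ext
    intro s
    exact MvPolynomial.aeval_C c s
  let y : limFree P (MvPolynomial I S) := limFreeMap P ι.hom.toRingHom x
  let p : MvPolynomial I S := h.1 T ι (limFreeScale P y MvPolynomial.X)
  have hp (c : I → S) : MvPolynomial.aeval c p = L c := by
    have hy : limFreeMap P (ev c).hom.toRingHom y = x := by
      apply Subtype.ext; funext α; ext i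
      exact MvPolynomial.aeval_C c (x.1 α i)
    have hc : (ev c).hom.toRingHom ∘ MvPolynomial.X = c :=
      funext fun i => MvPolynomial.aeval_X c i
    have h1 := h.2 T S ι (ev c) (limFreeScale P y MvPolynomial.X)
    rw [hev] at h1
    refine h1.trans (congrArg (h.1 S (𝟙 S)) ?_)
    exact (limFreeMap_limFreeScale P _ y _).trans (by rw [hy, hc]; rfl)
  have hvars : L (fun i => if i ∈ p.vars then 0 else 1) = 0 := by
    rw [← hp, MvPolynomial.aeval_eq_of_eqOn_vars p (d := 0), hp, _root_.map_zero]
    intro i hi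
    simp [hi]
  have hone : (1 : I → S) =
      (fun i => if i ∈ p.vars then 0 else 1) + ∑ j ∈ p.vars, Pi.single j (1 : S) := by
    funext i
    by_cases hi : i ∈ p.vars <;> simp [hi, Finset.sum_apply, Pi.single_apply]
  have hsingle (j : I) : L (Pi.single j 1) = 0 := by
    obtain ⟨s, hs⟩ := exists_limFreeScale_single hP x j
    change h.1 S (𝟙 S) (limFreeScale P x (Pi.single j 1)) = 0
    rw [hs]
    exact ((h.1 S (𝟙 S)).map_smul s _).trans (by rw [hj, smul_zero])
  have hL : L 1 = 0 := by
    rw [hone, _root_.map_add, hvars, map_sum, Finset.sum_eq_zero fun j _ => hsingle j, add_zero]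
  change h.1 S (𝟙 S) (limFreeScale P x 1) = 0 at hL
  rwa [limFreeScale_one] at hL

/-- A morphism over `S` from an essentially free functor to a dual functor is zero as soon as it
vanishes on the elements defined over `R`. -/
theorem restrictedHom_eq_zero {M : ModFunctor.{u, w₁} R} (hM : IsEssentiallyFree M)
    {M' : ModFunctor.{u, w₂} R} (hM' : IsDualFunctor.{u, w₂, w₃} M') (S : CommAlgCat.{u} R)
    (h : restrictedHom M M' S)
    (h0 : ∀ m : M.obj (CommAlgCat.of R R), h.1 S (𝟙 S) ((M.map (structureMap S)).hom m) = 0)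
    (x : M.obj S) : h.1 S (𝟙 S) x = 0 := by
  obtain ⟨I, P, hP, ⟨e⟩⟩ := hM
  obtain ⟨N, ⟨d⟩⟩ := hM'
  apply (d.app S).injective
  rw [_root_.map_zero]
  apply Subtype.ext; funext T φ; apply LinearMap.ext; intro n
  have hd {T' T'' : CommAlgCat.{u} R} (χ : T' ⟶ T'') (m : M'.obj T') (n : N.obj T'') :
      (d.app T'' ((M'.map χ).hom m)).1 T'' (𝟙 T'') n = (d.app T' m).1 T'' χ n := by
    rw [← d.naturality]
    change (d.app T' m).1 T'' (χ ≫ 𝟙 T'') n = _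
    rw [Category.comp_id]
  have he {T' T'' : CommAlgCat.{u} R} (χ : T' ⟶ T'') (y : (limFreeFunctor R P).obj T') :
      (M.map χ).hom ((e.app T').symm y) =
        (e.app T'').symm (((limFreeFunctor R P).map χ).hom y) := by
    rw [LinearEquiv.eq_symm_apply, ← e.naturality, LinearEquiv.apply_symm_apply]
  let k : restrictedHom (limFreeFunctor R P) (baseFunctor R) T :=
    ⟨fun T' ψ =>
      { toFun y := (d.app T' (h.1 T' (φ ≫ ψ) ((e.app T').symm y))).1 T' (𝟙 T') ((N.map ψ).hom n)
        map_add' y z := by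
          rw [_root_.map_add, _root_.map_add, _root_.map_add]
          rfl
        map_smul' t y := by
          rw [LinearEquiv.map_smul, LinearMap.map_smul, LinearEquiv.map_smul]
          rfl }, by
      intro T' T'' ψ χ y
      refine ((d.app T' (h.1 T' (φ ≫ ψ) ((e.app T').symm y))).2 T' T'' (𝟙 T') χ
        ((N.map ψ).hom n)).trans ?_
      change _ = (d.app T'' (h.1 T'' (φ ≫ ψ ≫ χ) ((e.app T'').symm
        (((limFreeFunctor R P).map χ).hom y)))).1 T'' (𝟙 T'') ((N.map (ψ ≫ χ)).hom n)
      rw [← he, ← Category.assoc, ← h.2 T' T'' (φ ≫ ψ) χ, hd, Category.id_comp, N.map_comp]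
      rfl⟩
  have hk (m : M.obj S) :
      k.1 T (𝟙 T) (e.app T ((M.map φ).hom m)) = (d.app S (h.1 S (𝟙 S) m)).1 T φ n := by
    change (d.app T (h.1 T (φ ≫ 𝟙 T) ((e.app T).symm (e.app T ((M.map φ).hom m))))).1 T (𝟙 T)
      ((N.map (𝟙 T)).hom n) = _
    rw [LinearEquiv.symm_apply_apply, Category.comp_id, N.map_id, ← hd φ, h.2 S T (𝟙 S) φ,
      Category.id_comp]
    rfl
  refine (hk x).symm.trans (restrictedHom_limFree_eq_zero hP T k (fun j => ?_) _)
  have hj := hk ((M.map (structureMap S)).hom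
    ((e.app (CommAlgCat.of R R)).symm (limFreeSingle P R j)))
  rw [h0, _root_.map_zero] at hj
  refine Eq.trans (congrArg (k.1 T (𝟙 T)) ?_) hj
  refine Eq.trans ?_ (((congrArg (e.app T) ((congrArg (M.map φ).hom (he _ _)).trans
    (he φ _))).trans ((e.app T).apply_symm_apply _)).symm)
  exact ((congrArg (limFreeMap P φ.hom.toRingHom) (limFreeMap_limFreeSingle P _ j)).trans
    (limFreeMap_limFreeSingle P _ j)).symm

variable {A : AlgFunctor.{u, w₁} R} {M : AModFunctor.{u, w₁, w₂} A}
  {M' : AModFunctor.{u, w₁, w₃} A} (f : ModFunctor.Hom M.toModFunctor M'.toModFunctor)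

/-- The defect `f (a m) - a f(m)` of linearity of `f`, as an `S`-bilinear map. -/
noncomputable def linearityDefect (S : CommAlgCat.{u} R) :
    A.toModFunctor.obj S →ₗ[S] M.obj S →ₗ[S] M'.obj S :=
  LinearMap.mk₂ S (fun (a : A.obj S) m => f.app S (a • m) - a • f.app S m)
    (fun (a b : A.obj S) m => by
      change f.app S ((a + b) • m) - (a + b) • f.app S m = _
      rw [add_smul, add_smul, _root_.map_add]
      abel)
    (fun s (a : A.obj S) m => by
      change f.app S ((s • a) • m) - (s • a) • f.app S m = _
      rw [smul_assoc, smul_assoc, LinearMap.map_smul, smul_sub])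
    (fun (a : A.obj S) m m' => by
      rw [smul_add, _root_.map_add, _root_.map_add, smul_add]
      abel)
    (fun s (a : A.obj S) m => by
      change f.app S (a • s • m) - a • f.app S (s • m) = s • (f.app S (a • m) - a • f.app S m)
      rw [smul_algebra_smul_comm, LinearMap.map_smul, LinearMap.map_smul, smul_algebra_smul_comm,
        smul_sub])

theorem map_linearityDefect {S T : CommAlgCat.{u} R} (φ : S ⟶ T) (a : A.toModFunctor.obj S)
    (m : M.obj S) :
    (M'.map φ).hom (linearityDefect f S a m) =
      linearityDefect f T ((A.toModFunctor.map φ).hom a) ((M.map φ).hom m) := by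
  change (M'.map φ).hom (f.app S ((show A.obj S from a) • m) - (show A.obj S from a) • f.app S m) =
    f.app T ((A.map φ).hom a • (M.map φ).hom m) - (A.map φ).hom a • f.app T ((M.map φ).hom m)
  rw [_root_.map_sub, f.naturality, M.map_asmul, M'.map_asmul, f.naturality]

/-- The linearity defect at `a`, as a morphism over `S`. -/
noncomputable def linearityDefectLeft (S : CommAlgCat.{u} R) (a : A.toModFunctor.obj S) :
    restrictedHom M.toModFunctor M'.toModFunctor S :=
  ⟨fun T φ => linearityDefect f T ((A.toModFunctor.map φ).hom a), by
    intro T T' φ ψ m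
    change _ = linearityDefect f T' ((A.toModFunctor.map (φ ≫ ψ)).hom a) ((M.map ψ).hom m)
    rw [map_linearityDefect, A.toModFunctor.map_comp]
    rfl⟩

/-- The linearity defect at `m`, as a morphism over `S`. -/
noncomputable def linearityDefectRight (S : CommAlgCat.{u} R) (m : M.obj S) :
    restrictedHom A.toModFunctor M'.toModFunctor S :=
  ⟨fun T φ => (linearityDefect f T).flip ((M.map φ).hom m), by
    intro T T' φ ψ a
    rw [LinearMap.flip_apply, LinearMap.flip_apply, map_linearityDefect, M.map_comp]
    rfl⟩

/-- The linearity defect vanishes as soon as it vanishes over `R`. -/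
theorem linearityDefect_eq_zero (hA : IsEssentiallyFree A.toModFunctor)
    (hM : IsEssentiallyFree M.toModFunctor) (hM' : IsDualFunctor.{u, w₃, w₄} M'.toModFunctor)
    (h0 : ∀ a m, linearityDefect f (CommAlgCat.of R R) a m = 0) (S : CommAlgCat.{u} R)
    (a : A.toModFunctor.obj S) (m : M.obj S) : linearityDefect f S a m = 0 := by
  have hleft (a : A.toModFunctor.obj S) (m : M.obj S) :
      (linearityDefectLeft f S a).1 S (𝟙 S) m = linearityDefect f S a m := by
    change linearityDefect f S ((A.toModFunctor.map (𝟙 S)).hom a) m = _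
    rw [A.toModFunctor.map_id]
    rfl
  have hright (a : A.toModFunctor.obj S) (m : M.obj S) :
      (linearityDefectRight f S m).1 S (𝟙 S) a = linearityDefect f S a m := by
    change linearityDefect f S a ((M.map (𝟙 S)).hom m) = _
    rw [M.map_id]
    rfl
  rw [← hleft]
  refine restrictedHom_eq_zero hM hM' S _ (fun m => ?_) m
  rw [hleft, ← hright]
  refine restrictedHom_eq_zero hA hM' S _ (fun a => ?_) a
  rw [hright, ← map_linearityDefect, h0, _root_.map_zero]

end EssFree

theorem mainTheorem7 {R : Type u} [CommRing R]
    (A : EssFree.AlgFunctor.{u, w₁} R)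
    (hA : EssFree.IsEssentiallyFree A.toModFunctor)
    (M : EssFree.AModFunctor.{u, w₁, w₂} A)
    (hM : EssFree.IsEssentiallyFree M.toModFunctor)
    (M' : EssFree.AModFunctor.{u, w₁, w₃} A)
    (hM' : EssFree.IsDualFunctor.{u, w₃, w₄} M'.toModFunctor)
    (f : EssFree.ModFunctor.Hom M.toModFunctor M'.toModFunctor) :
    EssFree.IsAModHom M M' f ↔
      IsLinearMap (A.obj (CommAlgCat.of R R)) (f.app (CommAlgCat.of R R)) := by
  refine ⟨fun h => h _, fun h S => ⟨(f.app S).map_add, fun a m => ?_⟩⟩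
  exact sub_eq_zero.mp (EssFree.linearityDefect_eq_zero f hA hM hM'
    (fun a m => sub_eq_zero.mpr (h.map_smul a m)) S a m)
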